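/- Graphs are finite multigraphs (loops and parallel edges allowed); each edge consists of two distinct half-edges, each incident on one vertex, and a directed version of a graph designates one half-edge of each edge as initial. A closed walk lists half-edges $h_1,h_1',\dots,h_k,h_k'$, where $h_i,h_i'$ are the two half-edges of an edge and $h_i'$, $h_{i+1}$ (indices mod $k$) are incident on the same vertex; it is considered up to cyclic permutation. A circuit is a closed walk with $k\ge 1$ and pairwise distinct edges. For a directed version $D$ of a graph $G$ and a closed walk $W$, $z_D(W)\in\mathbb{R}^{E(G)}$ is the vector whose $e$ coordinate is the number of times $W$ passes through $e$ in the direction of $D$ minus the number of times it does so in the opposite direction; $Z_D(G)$ is the span of all $z_D(W)$, $W$ a closed walk in $G$. Let $F$ be a 4-regular graph (each vertex is incident with four half-edges). An Euler system $C$ of $F$ consists of one circuit for each connected component of $F$, which traverses every edge of that component exactly once. For $v\in V(F)$, the fundamental circuits $C_1(C,v)$ and $C_2(C,v)$ are the two closed trails obtained by following a circuit of $C$ from $v$ to $v$. A circuit partition $P$ of $F$ is a set of circuits such that each edge of $F$ is traversed by exactly one of them. At each vertex $v$, the passages of circuits of $P$ through $v$ partition the four half-edges at $v$ into two pairs, the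 single transitions of $P$ at $v$. The touch-graph $Tch(P)$ has a vertex $v_\gamma$ for each $\gamma\in P$ and an edge $e_v$ for each $v\in V(F)$; the two half-edges of $e_v$ are the two single transitions of $P$ at $v$, each incident on the vertex $v_\gamma$ of the circuit $\gamma$ that includes it. For a half-edge $h$ of $F$ let $\overline{h}$ be the single transition of $P$ that contains $h$. The projection $\pi_P(W)=\overline W$ of a closed walk $W=(h_1,h_1',\dots,h_k,h_k')$ is the closed walk in $Tch(P)$ obtained from the cyclic list of pairs $(\overline{h_1'},\overline{h_2}),\dots,(\overline{h_k'},\overline{h_1})$ by deleting the pairs with $\overline{h_i'}=\overline{h_{i+1}}$. **Theorem.** Let $C$ be an Euler system of a 4-regular graph $F$, and let $\Gamma$ be a set of fundamental circuits of $C$ which includes at least one of $C_1(C,v),C_2(C,v)$ for each $v\in V(F)$. Then for every circuit partition $P$ of $F$ and every directed version $D$ of $Tch(P)$, the set $S=\{z_D(\overline{\gamma})\mid\gamma\in\Gamma\}$ spans the subspace $Z_D(Tch(P))$ of $\mathbb{R}^{E(Tch(P))}$. -/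

import Mathlib

/-- A multigraph (loops and parallel edges allowed) with vertex set `V`, edge set `E` and set of
half-edges `H`: each half-edge is incident on one vertex, and each edge consists of two distinct
half-edges. -/
structure HalfEdgeGraph (V E H : Type*) where
  /-- the vertex on which a half-edge is incident -/
  vert : H → V
  /-- the edge to which a half-edge belongs -/
  edge : H → E
  ncard_edge : ∀ e, {h | edge h = e}.ncard = 2

namespace HalfEdgeGraph

section Basic

variable {V E H : Type*} (G : HalfEdgeGraph V E H)

theorem exists_mate (h : H) : ∃ k, k ≠ h ∧ G.edge k = G.edge h := by
  obtain ⟨a, b, hab, hs⟩ := Set.ncard_eq_two.1 (G.ncard_edge (G.edge h))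
  have hh : h ∈ ({a, b} : Set H) := hs ▸ (rfl : G.edge h = G.edge h)
  have ha : G.edge a = G.edge h := by
    have : a ∈ {k | G.edge k = G.edge h} := hs ▸ Set.mem_insert a _
    exact this
  have hb : G.edge b = G.edge h := by
    have : b ∈ {k | G.edge k = G.edge h} := hs ▸ Set.mem_insert_of_mem a rfl
    exact this
  rcases hh with rfl | rfl
  · exact ⟨b, hab.symm, hb⟩
  · exact ⟨a, hab, ha⟩

/-- The other half-edge of the edge to which `h` belongs. -/
noncomputable def mate (h : H) : H := (G.exists_mate h).choose

theorem mate_ne (h : H) : G.mate h ≠ h := (G.exists_mate h).choose_spec.1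

@[simp] theorem edge_mate (h : H) : G.edge (G.mate h) = G.edge h :=
  (G.exists_mate h).choose_spec.2

theorem eq_or_eq_mate {h k : H} (hk : G.edge k = G.edge h) : k = h ∨ k = G.mate h := by
  obtain ⟨a, b, hab, hs⟩ := Set.ncard_eq_two.1 (G.ncard_edge (G.edge h))
  have key : ∀ x, G.edge x = G.edge h → x = a ∨ x = b := fun x hx => by
    have : x ∈ ({a, b} : Set H) := hs ▸ hx
    simpa using this
  have h1 := key k hk
  have h2 := key h rfl
  have h3 := key (G.mate h) (G.edge_mate h)
  have h4 := G.mate_ne h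
  grind

@[simp] theorem mate_mate (h : H) : G.mate (G.mate h) = h := by
  rcases G.eq_or_eq_mate (h := h) (k := G.mate (G.mate h)) (by simp) with h1 | h1
  · exact h1
  · exact absurd h1 (G.mate_ne _)

/-- Every vertex has exactly four incident half-edges. -/
def IsFourRegular : Prop := ∀ v, {h | G.vert h = v}.ncard = 4

/-- The closed walk `v₁, h₁, h₁', v₂, …, v_k, h_k, h_k', v₁` is recorded as the cyclic list
`h₁, …, h_k` of the half-edges along which it leaves its vertices; then `h_i' = mate h_i`. Cyclic
lists are lists up to rotation, so closed walks which differ by a cyclic permutation agree, and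
closed walks with opposite orientations are different. All closed walks without edges are recorded
as the empty list. -/
def IsClosedWalk (W : Cycle H) : Prop := W.Chain fun h k => G.vert (G.mate h) = G.vert k

/-- A circuit is a closed trail, i.e. a closed walk with pairwise distinct edges; circuits without
edges are not admitted. -/
structure IsCircuit (W : Cycle H) : Prop where
  isClosedWalk : G.IsClosedWalk W
  nodup_edge : (W.map G.edge).Nodup
  ne_nil : W ≠ Cycle.nil

/-- The edge `e` appears on `W`, in either direction. -/
def Traverses (W : Cycle H) (e : E) : Prop := ∃ h ∈ W, G.edge h = e

/-- Two vertices are adjacent if they are the end-vertices of an edge. -/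
def Adj (u v : V) : Prop := ∃ h, G.vert h = u ∧ G.vert (G.mate h) = v

/-- Connected components: classes of the equivalence relation generated by adjacency. -/
def Component : Type _ := Quot G.Adj

/-- The connected component of a vertex. -/
def componentMk (v : V) : G.Component := Quot.mk _ v

/-- An Euler system: for each connected component, a circuit that traverses (exactly once) the edges
of this component, and no others. -/
structure EulerSystem where
  circuit : G.Component → Cycle H
  isCircuit : ∀ K, G.IsCircuit (circuit K)
  traverses_iff : ∀ K h, G.Traverses (circuit K) (G.edge h) ↔ G.componentMk (G.vert h) = K

/-- `W` is one of the two fundamental circuits of `C` at `v`: follow a circuit of `C` from one of its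
passages through `v` to the other one. -/
def EulerSystem.IsFundamentalCircuit {G : HalfEdgeGraph V E H} (C : G.EulerSystem) (v : V)
    (W : Cycle H) : Prop :=
  ∃ (K : G.Component) (h₁ : H) (l₁ : List H) (h₂ : H) (l₂ : List H),
    C.circuit K = (((h₁ :: l₁) ++ (h₂ :: l₂) : List H) : Cycle H) ∧
      G.vert h₁ = v ∧ G.vert h₂ = v ∧ W = ((h₁ :: l₁ : List H) : Cycle H)

/-- A directed version of a graph: one half-edge of each edge is designated as initial. -/
structure Orientation where
  init : E → H
  edge_init : ∀ e, G.edge (init e) = e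

open Classical in
/-- The vector of a walk: in the coordinate `e`, the number of times that the walk passes through `e`
in the chosen direction, minus the number of times that it does so in the opposite direction. -/
noncomputable def Orientation.walkVector {G : HalfEdgeGraph V E H} (D : G.Orientation) (W : Cycle H) :
    E → ℝ :=
  fun e => (W.toMultiset.count (D.init e) : ℝ) - (W.toMultiset.count (G.mate (D.init e)) : ℝ)

/-- The real cycle space: the span of the vectors of all closed walks. -/
noncomputable def Orientation.cycleSpace {G : HalfEdgeGraph V E H} (D : G.Orientation) :
    Submodule ℝ (E → ℝ) :=
  Submodule.span ℝ {z | ∃ W, G.IsClosedWalk W ∧ z = D.walkVector W}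

/-- A circuit partition: a set of circuits such that every edge is traversed by exactly one of them
(and then exactly once). The direction in which a circuit of the partition is traversed has no
influence on the notions that are derived from the partition below. -/
structure CircuitPartition where
  circuits : Set (Cycle H)
  isCircuit : ∀ W ∈ circuits, G.IsCircuit W
  existsUnique : ∀ e, ∃! W, W ∈ circuits ∧ G.Traverses W e

end Basic

section Facts

variable {V E H : Type*} {G : HalfEdgeGraph V E H}

theorem IsCircuit.nodup {W : Cycle H} (hW : G.IsCircuit W) : W.Nodup := by
  have h := hW.nodup_edge
  induction W using Quotient.inductionOn' with
  | h l => exact List.Nodup.of_map G.edge h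

theorem IsCircuit.mate_notMem {W : Cycle H} (hW : G.IsCircuit W) {h : H} (hh : h ∈ W) :
    G.mate h ∉ W := by
  have hn := hW.nodup_edge
  induction W using Quotient.inductionOn' with
  | h l =>
    intro hm
    exact G.mate_ne h (List.inj_on_of_nodup_map (f := G.edge) hn hm hh (by simp))

theorem chain_next {α : Type*} [DecidableEq α] {r : α → α → Prop} {s : Cycle α} (hs : s.Nodup)
    (hc : s.Chain r) {a : α} (ha : a ∈ s) : r a (s.next hs a ha) := by
  induction s using Quotient.inductionOn' with
  | h l =>
    have ha' : a ∈ l := ha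
    obtain ⟨l₁, l₂, rfl⟩ := List.append_of_mem ha'
    have e : (((l₁ ++ a :: l₂ : List α)) : Cycle α) = ((a :: (l₂ ++ l₁) : List α) : Cycle α) :=
      Cycle.coe_eq_coe.2 (by simpa using List.isRotated_append (l := l₁) (l' := a :: l₂))
    have key : ∀ (m : List α) (t : Cycle α) (ht : t.Nodup) (h' : a ∈ t), t.Chain r →
        t = ((a :: m : List α) : Cycle α) → r a (t.next ht a h') := by
      rintro m t ht h' hch rfl
      cases m with
      | nil =>
        change r a (List.next [a] a (by simp))
        simpa [List.next] using (Cycle.chain_singleton r a).1 hch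
      | cons b m =>
        change r a (List.next (a :: b :: m) a (by simp))
        rw [List.next_cons_cons_eq]
        rw [Cycle.chain_coe_cons] at hch
        simp at hch
        exact hch.1
    exact key _ _ hs ha hc e

end Facts

namespace CircuitPartition

variable {V E H : Type*} {G : HalfEdgeGraph V E H} (P : G.CircuitPartition)

/-- The circuit of the partition on which a given edge lies. -/
noncomputable def circuitOf (e : E) : P.circuits :=
  ⟨(P.existsUnique e).choose, (P.existsUnique e).choose_spec.1.1⟩

theorem traverses_circuitOf (e : E) : G.Traverses (P.circuitOf e : Cycle H) e :=
  (P.existsUnique e).choose_spec.1.2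

theorem eq_circuitOf {W : Cycle H} (hW : W ∈ P.circuits) {e : E} (he : G.Traverses W e) :
    W = P.circuitOf e :=
  (P.existsUnique e).choose_spec.2 W ⟨hW, he⟩

theorem isCircuit_circuitOf (e : E) : G.IsCircuit (P.circuitOf e : Cycle H) :=
  P.isCircuit _ (P.circuitOf e).2

theorem circuitOf_of_mem {e : E} {k : H} (hk : k ∈ (P.circuitOf e : Cycle H)) :
    P.circuitOf (G.edge k) = P.circuitOf e :=
  Subtype.ext (P.eq_circuitOf (P.circuitOf e).2 ⟨k, hk, rfl⟩).symm

theorem mate_mem_of_notMem {h : H} (hh : h ∉ (P.circuitOf (G.edge h) : Cycle H)) :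
    G.mate h ∈ (P.circuitOf (G.edge h) : Cycle H) := by
  obtain ⟨k, hk, hke⟩ := P.traverses_circuitOf (G.edge h)
  rcases G.eq_or_eq_mate hke with rfl | rfl
  · exact absurd hk hh
  · exact hk

open Classical in
/-- The half-edge that forms a single transition of the partition together with `h`: if a circuit of
the partition leaves a vertex along `h`, the half-edge by which this passage enters the vertex; if it
enters a vertex along `h`, the half-edge by which this passage leaves the vertex. -/
noncomputable def partner (h : H) : H :=
  if hh : h ∈ (P.circuitOf (G.edge h) : Cycle H) then
    G.mate ((P.circuitOf (G.edge h) : Cycle H).prev (P.isCircuit_circuitOf _).nodup h hh)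
  else
    (P.circuitOf (G.edge h) : Cycle H).next (P.isCircuit_circuitOf _).nodup (G.mate h)
      (P.mate_mem_of_notMem hh)

open Classical in
theorem partner_of_mem {W : Cycle H} (hW : W ∈ P.circuits) {h : H} (hh : h ∈ W) :
    P.partner h = G.mate (W.prev (P.isCircuit W hW).nodup h hh) := by
  obtain rfl := P.eq_circuitOf hW ⟨h, hh, rfl⟩
  rw [partner, dif_pos hh]

open Classical in
theorem partner_of_mate_mem {W : Cycle H} (hW : W ∈ P.circuits) {h : H} (hh : G.mate h ∈ W) :
    P.partner h = W.next (P.isCircuit W hW).nodup (G.mate h) hh := by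
  have hn : h ∉ W := by simpa using (P.isCircuit W hW).mate_notMem hh
  obtain rfl := P.eq_circuitOf (e := G.edge h) hW ⟨G.mate h, hh, by simp⟩
  rw [partner, dif_neg hn]

theorem exists_mem (h : H) : ∃ W ∈ P.circuits, h ∈ W ∨ G.mate h ∈ W := by
  refine ⟨_, (P.circuitOf (G.edge h)).2, ?_⟩
  by_cases hh : h ∈ (P.circuitOf (G.edge h) : Cycle H)
  · exact Or.inl hh
  · exact Or.inr (P.mate_mem_of_notMem hh)

@[simp] theorem partner_partner (h : H) : P.partner (P.partner h) = h := by
  classical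
  obtain ⟨W, hW, hh | hh⟩ := P.exists_mem h
  · rw [P.partner_of_mem hW hh, P.partner_of_mate_mem hW (by simpa using Cycle.prev_mem _ _ _ _)]
    simp only [mate_mate]
    exact Cycle.next_prev _ _ _ _
  · rw [P.partner_of_mate_mem hW hh, P.partner_of_mem hW (Cycle.next_mem _ _ _ _),
      Cycle.prev_next, mate_mate]

theorem partner_ne (h : H) : P.partner h ≠ h := by
  classical
  obtain ⟨W, hW, hh | hh⟩ := P.exists_mem h
  · rw [P.partner_of_mem hW hh]
    intro e
    exact (P.isCircuit W hW).mate_notMem (Cycle.prev_mem _ _ _ _) (e.symm ▸ hh)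
  · rw [P.partner_of_mate_mem hW hh]
    intro e
    have h1 : h ∈ W := by
      have h2 := Cycle.next_mem W (P.isCircuit W hW).nodup (G.mate h) hh
      rwa [e] at h2
    exact (P.isCircuit W hW).mate_notMem h1 hh

theorem vert_partner (h : H) : G.vert (P.partner h) = G.vert h := by
  classical
  obtain ⟨W, hW, hh | hh⟩ := P.exists_mem h
  · rw [P.partner_of_mem hW hh]
    have h1 := chain_next (P.isCircuit W hW).nodup (P.isCircuit W hW).isClosedWalk
      (Cycle.prev_mem W (P.isCircuit W hW).nodup h hh)
    rwa [Cycle.next_prev] at h1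
  · rw [P.partner_of_mate_mem hW hh]
    have h1 := chain_next (P.isCircuit W hW).nodup (P.isCircuit W hW).isClosedWalk hh
    rw [mate_mate] at h1
    exact h1.symm

theorem circuitOf_edge_partner (h : H) :
    P.circuitOf (G.edge (P.partner h)) = P.circuitOf (G.edge h) := by
  classical
  obtain ⟨W, hW, hh | hh⟩ := P.exists_mem h
  · rw [P.partner_of_mem hW hh, edge_mate]
    exact Subtype.ext ((P.eq_circuitOf hW ⟨_, Cycle.prev_mem _ _ _ _, rfl⟩).symm.trans
      (P.eq_circuitOf hW ⟨h, hh, rfl⟩))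
  · rw [P.partner_of_mate_mem hW hh]
    exact Subtype.ext ((P.eq_circuitOf hW ⟨_, Cycle.next_mem _ _ _ _, rfl⟩).symm.trans
      (P.eq_circuitOf hW ⟨_, hh, by simp⟩))

/-- Two half-edges are equivalent if they are equal or form a single transition of the partition. -/
def transitionSetoid : Setoid H where
  r h k := k = h ∨ k = P.partner h
  iseqv :=
    { refl := fun _ => Or.inl rfl
      symm := by
        rintro x y (rfl | rfl)
        · exact Or.inl rfl
        · exact Or.inr (by simp)
      trans := by
        rintro x y z (rfl | rfl) (rfl | rfl) <;> simp }

/-- The half-edges of the touch-graph are the single transitions of the partition, i.e. the two-element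
classes `{h, partner h}`. -/
def TouchHalfEdge : Type _ := Quotient P.transitionSetoid

/-- The two-to-one projection from half-edges of the graph to half-edges of the touch-graph. -/
def proj (h : H) : P.TouchHalfEdge := Quotient.mk P.transitionSetoid h

theorem proj_eq_proj {h k : H} : P.proj h = P.proj k ↔ k = h ∨ k = P.partner h :=
  Quotient.eq (r := P.transitionSetoid)

theorem proj_surjective : Function.Surjective P.proj := Quotient.mk_surjective

/-- The circuit that includes a single transition. -/
noncomputable def touchVert : P.TouchHalfEdge → P.circuits :=
  Quotient.lift (fun h => P.circuitOf (G.edge h)) (by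
    rintro a b (rfl | rfl)
    · rfl
    · exact (P.circuitOf_edge_partner a).symm)

/-- The vertex of the graph at which a single transition takes place. -/
def touchEdge : P.TouchHalfEdge → V :=
  Quotient.lift G.vert (by
    rintro a b (rfl | rfl)
    · rfl
    · exact (P.vert_partner a).symm)

theorem touchEdge_proj (h : H) : P.touchEdge (P.proj h) = G.vert h := rfl

theorem touchVert_proj (h : H) : P.touchVert (P.proj h) = P.circuitOf (G.edge h) := rfl

theorem ncard_touchEdge (hG : G.IsFourRegular) (v : V) :
    {t | P.touchEdge t = v}.ncard = 2 := by
  have h4 := hG v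
  have hfin : {h | G.vert h = v}.Finite := Set.finite_of_ncard_ne_zero (by omega)
  obtain ⟨a, ha⟩ : {h | G.vert h = v}.Nonempty := Set.nonempty_of_ncard_ne_zero (by omega)
  have hpa : P.partner a ∈ {h | G.vert h = v} := (P.vert_partner a).trans ha
  obtain ⟨b, hb, hbn⟩ : ∃ b ∈ {h | G.vert h = v}, b ∉ ({a, P.partner a} : Set H) := by
    refine Set.exists_mem_notMem_of_ncard_lt_ncard ?_ (Set.toFinite _)
    have := Set.ncard_insert_le a {P.partner a}
    simp only [Set.ncard_singleton] at this
    omega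
  have hpb : P.partner b ∈ {h | G.vert h = v} := (P.vert_partner b).trans hb
  simp only [Set.mem_insert_iff, Set.mem_singleton_iff, not_or] at hbn
  have hbn' : P.partner b ≠ a ∧ P.partner b ≠ P.partner a := by
    constructor
    · intro e
      exact hbn.2 (by rw [← e, partner_partner])
    · intro e
      exact hbn.1 (by rw [← P.partner_partner b, e, partner_partner])
  have h1 := P.partner_ne a
  have h2 := P.partner_ne b
  have hsub : ({a, P.partner a, b, P.partner b} : Set H) ⊆ {h | G.vert h = v} := by
    rintro x (rfl | rfl | rfl | rfl) <;> assumption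
  have hcard : ({a, P.partner a, b, P.partner b} : Set H).ncard = 4 := by
    rw [Set.ncard_insert_of_notMem, Set.ncard_insert_of_notMem, Set.ncard_pair h2.symm]
    · simp only [Set.mem_insert_iff, Set.mem_singleton_iff]
      grind
    · simp only [Set.mem_insert_iff, Set.mem_singleton_iff]
      grind
  have heq := Set.eq_of_subset_of_ncard_le hsub (by omega) hfin
  refine Set.ncard_eq_two.2 ⟨P.proj a, P.proj b, ?_, ?_⟩
  · rw [Ne, proj_eq_proj]
    tauto
  · ext t
    obtain ⟨x, rfl⟩ := P.proj_surjective t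
    simp only [Set.mem_ofPred_eq, touchEdge_proj, Set.mem_insert_iff, Set.mem_singleton_iff,
      proj_eq_proj]
    have hx : G.vert x = v ↔ x = a ∨ x = P.partner a ∨ x = b ∨ x = P.partner b := by
      have : x ∈ {h | G.vert h = v} ↔ x ∈ ({a, P.partner a, b, P.partner b} : Set H) := by rw [heq]
      simpa using this
    rw [hx]
    have e1 := P.partner_partner x
    have e2 := P.partner_partner a
    have e3 := P.partner_partner b
    grind

/-- The touch-graph of a circuit partition of a 4-regular graph. Its vertices are the circuits of the
partition, its edges are the vertices `v` of the graph, the half-edges of the edge `v` are the two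
single transitions of the partition at `v`, and each of these is incident on the circuit that includes
it. -/
noncomputable def touchGraph (hG : G.IsFourRegular) :
    HalfEdgeGraph P.circuits V P.TouchHalfEdge where
  vert := P.touchVert
  edge := P.touchEdge
  ncard_edge := P.ncard_touchEdge hG

open Classical in
/-- Projection of a listed closed walk `h₁, …, h_k`: for each `i` (cyclically) the projected walk leaves
the circuit through the edge `{h_i, h_i'}` along the half-edge `proj h_i'`, and arrives at the circuit
through the edge `{h_{i+1}, h_{i+1}'}` by the half-edge `proj h_{i+1}`; this step is deleted when
`proj h_i' = proj h_{i+1}`. -/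
noncomputable def projList (l : List H) : List P.TouchHalfEdge :=
  (List.zip l (l.rotate 1)).filterMap fun p =>
    if P.proj (G.mate p.1) = P.proj p.2 then none else some (P.proj (G.mate p.1))

theorem projList_isRotated {l l' : List H} (h : l ~r l') : P.projList l ~r P.projList l' := by
  obtain ⟨n, rfl⟩ := h
  have e : List.zip (l.rotate n) ((l.rotate n).rotate 1) = (List.zip l (l.rotate 1)).rotate n := by
    change List.zipWith Prod.mk _ _ = (List.zipWith Prod.mk _ _).rotate n
    rw [List.zipWith_rotate_distrib _ _ _ _ (by simp), List.rotate_rotate,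
      List.rotate_rotate, Nat.add_comm]
  unfold projList
  rw [e]
  generalize List.zip l (l.rotate 1) = m
  rw [List.rotate_eq_drop_append_take_mod, List.filterMap_append]
  conv_lhs => rw [← List.take_append_drop (n % m.length) m, List.filterMap_append]
  exact List.isRotated_append

/-- The projection of closed walks of the graph to closed walks of the touch-graph. -/
noncomputable def projWalk : Cycle H → Cycle P.TouchHalfEdge :=
  Quotient.map P.projList fun _ _ h => P.projList_isRotated h

end CircuitPartition

end HalfEdgeGraph

/-!
Fix a circuit partition `P` and a directed version `D` of the touch-graph, and let `σ h` be the unit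
vector `e_v` if the single transition of `P` that contains `h` is the initial half-edge of `e_v`, and
`0` otherwise. A passage `(h', k)` of a walk of `F` contributes `σ h' - σ k` to the vector of the
projected walk, deleted steps included. So this vector is the sum of the increments `σ (mate h) - σ h`
over the half-edges `h` along which the walk proceeds (`walkVector_projWalk`), which makes projection a
linear map on chains of `F`.

Integrally, the fundamental circuits in `Γ` and the circuits of the Euler system generate all cycles of
`F`. The dual form of this is `EulerSystem.exists_potential`: an antisymmetric function on half-edges,
with values in any abelian group, that has sum zero along these circuits is the increment of a function
on vertices.

The Euler circuits themselves are not needed, because the span `N` of the projections of `Γ` contains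
their projections (`EulerSystem.sum_circuit_eq_zero`). In one component, the Euler circuit and the
circuits of `P` traverse the same edges, so they differ by twice an integral cycle, namely the set of
edges on which their directions disagree. The circuits of `P` project to zero. Hence modulo `N` the
projection `m` of the Euler circuit is an even multiple `2 a m` of itself, and `m = 0` since `1 - 2 a`
is a nonzero integer.

Therefore, modulo `N`, the increment of `σ` has a potential `ψ` on the vertices of `F`. The function
`ψ (vert h) - σ h` is then the same at both half-edges of every edge and of every single transition, so
it is constant on the circuits of `P`, that is, a function on the vertices of the touch-graph. Its
increments are the steps of the touch-graph modulo `N`, and they telescope to zero along every closed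
walk of the touch-graph. So all vectors of such walks belong to `N`.
-/

namespace HalfEdgeGraph

/-! ### Telescoping along cyclic lists -/

/-- Telescoping: if `Φ` grows by `φ h` at each step of the list, then the total growth of `Φ` is the
sum of `φ`. -/
theorem eq_add_sum_of_isChain {α M : Type*} [AddCommGroup M] {Φ φ : α → M} {b : α} :
    ∀ {a : α} {l : List α}, List.IsChain (fun h k => Φ k = Φ h + φ h) (a :: (l ++ [b])) →
      Φ b = Φ a + ((a :: l).map φ).sum
  | a, [], h => by simpa using h
  | a, c :: l, h => by
    rw [List.cons_append, List.isChain_cons_cons] at h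
    rw [eq_add_sum_of_isChain h.2, h.1]
    simp [add_assoc]

theorem sum_eq_zero_of_chain {α M : Type*} [AddCommGroup M] {Φ φ : α → M} {W : Cycle α}
    (h : W.Chain fun h k => Φ k = Φ h + φ h) : (W.toMultiset.map φ).sum = 0 := by
  induction W using Cycle.induction_on with
  | nil => simp
  | cons a l _ =>
    have := eq_add_sum_of_isChain ((Cycle.chain_coe_cons _ a l).1 h)
    simpa using this

/-- A function with sum zero along a cyclic list of distinct elements is a difference of consecutive
values of some other function. -/
theorem exists_chain_of_sum_eq_zero {α M : Type*} [AddCommGroup M] (φ : α → M) {W : Cycle α}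
    (hW : W.Nodup) (h0 : (W.toMultiset.map φ).sum = 0) :
    ∃ Φ : α → M, W.Chain fun h k => Φ k = Φ h + φ h := by
  classical
  induction W using Cycle.induction_on with
  | nil => exact ⟨0, trivial⟩
  | cons a l _ =>
    have hn : (a :: l).Nodup := hW
    have hs : ((a :: l).map φ).sum = 0 := by simpa using h0
    -- `Φ` consists of the partial sums of `φ`, starting from `a`.
    let Φ : α → M := fun h => (((a :: l).map φ).take ((a :: l).idxOf h)).sum
    have hΦ : ∀ i (hi : i < (a :: l).length),
        Φ (a :: l)[i] = (((a :: l).map φ).take i).sum := fun i hi => by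
      simp only [Φ]
      rw [hn.idxOf_getElem i hi]
    refine ⟨Φ, (Cycle.chain_coe_cons _ a l).2 ?_⟩
    rw [← List.cons_append, List.isChain_iff_getElem]
    intro i hi
    have hi' : i < (a :: l).length := by simpa using hi
    rw [List.getElem_append_left hi', hΦ i hi']
    have hstep := List.sum_take_succ ((a :: l).map φ) i (by simpa using hi')
    rw [List.getElem_map] at hstep
    rw [← hstep]
    rcases Nat.lt_or_ge (i + 1) (a :: l).length with h1 | h1
    · rw [List.getElem_append_left h1, hΦ _ h1]
    · rw [List.getElem_append_right h1, List.take_of_length_le (by simpa using h1), hs]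
      have h2 : Φ a = 0 := hΦ 0 (by simp)
      simpa using h2

theorem forall_mem_zip_of_isChain {α : Type*} {r : α → α → Prop} {b : α} :
    ∀ {a : α} {l : List α}, List.IsChain r (a :: (l ++ [b])) →
      ∀ p ∈ List.zip (a :: l) (l ++ [b]), r p.1 p.2
  | a, [], h => by simpa using h
  | a, c :: l, h => by
    rw [List.cons_append, List.isChain_cons_cons] at h
    rw [List.cons_append, List.zip_cons_cons]
    intro p hp
    rcases List.mem_cons.1 hp with rfl | hp
    · exact h.1
    · exact forall_mem_zip_of_isChain h.2 p hp

theorem isChain_of_chain_append {α : Type*} {h₁ h₂ : α} {l₁ l₂ : List α} {r : α → α → Prop}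
    (h : Cycle.Chain r (((h₁ :: l₁) ++ (h₂ :: l₂) : List α) : Cycle α)) :
    List.IsChain r (h₁ :: (l₁ ++ [h₂])) := by
  rw [List.cons_append, Cycle.chain_coe_cons] at h
  have e : h₁ :: (l₁ ++ h₂ :: l₂ ++ [h₁]) = (h₁ :: (l₁ ++ [h₂])) ++ (l₂ ++ [h₁]) := by simp
  rw [e, List.isChain_append] at h
  exact h.1

/-! ### Walks and their vectors -/

section Walks

variable {V E H : Type*} (G : HalfEdgeGraph V E H)

/-- The list of half-edges `l` is a walk from `u` to `v`. -/
def IsWalk : V → List H → V → Prop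
  | u, [], v => u = v
  | u, h :: l, v => G.vert h = u ∧ IsWalk (G.vert (G.mate h)) l v

variable {G}

theorem IsWalk.isChain {b : H} : ∀ {a : H} {l : List H} {u v : V}, G.IsWalk u (a :: l) v →
    G.vert b = v → List.IsChain (fun h k => G.vert (G.mate h) = G.vert k) (a :: (l ++ [b]))
  | a, [], u, v, h, hb => by
    have h2 : G.vert (G.mate a) = v := h.2
    simpa [hb] using h2
  | a, c :: l, u, v, h, hb => by
    rw [List.cons_append, List.isChain_cons_cons]
    exact ⟨h.2.1.symm, IsWalk.isChain h.2 hb⟩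

theorem IsWalk.isClosedWalk {l : List H} {u : V} (h : G.IsWalk u l u) :
    G.IsClosedWalk (l : Cycle H) := by
  cases l with
  | nil => trivial
  | cons a l => exact (Cycle.chain_coe_cons _ a l).2 (h.isChain h.1)

theorem IsClosedWalk.sum_sub {M : Type*} [AddCommGroup M] (f : V → M) {W : Cycle H}
    (hW : G.IsClosedWalk W) :
    (W.toMultiset.map fun h => f (G.vert (G.mate h)) - f (G.vert h)).sum = 0 := by
  refine sum_eq_zero_of_chain (Φ := fun h => f (G.vert h)) (Cycle.Chain.imp ?_ hW)
  intro a b h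
  simp [h]

open Classical in
/-- The indicator of the initial half-edges, placed in the coordinate of the edge. -/
noncomputable def Orientation.initVector (D : G.Orientation) (h : H) : E → ℝ :=
  Pi.single (G.edge h) (if h = D.init (G.edge h) then 1 else 0)

theorem Orientation.initVector_sub (D : G.Orientation) (h : H) (e : E) [DecidableEq H] :
    (D.initVector h - D.initVector (G.mate h)) e =
      (if h = D.init e then 1 else 0) - (if h = G.mate (D.init e) then 1 else 0) := by
  classical
  by_cases he : e = G.edge h
  · subst he
    have h1 : G.mate h = D.init (G.edge h) ↔ h = G.mate (D.init (G.edge h)) :=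
      ⟨fun k => by rw [← k, mate_mate], fun k => by
        conv_lhs => rw [k]
        exact mate_mate _ _⟩
    simp [initVector, h1]
  · have h1 : h ≠ D.init e := fun k => he (by rw [k, D.edge_init])
    have h2 : h ≠ G.mate (D.init e) := fun k => he (by rw [k, edge_mate, D.edge_init])
    simp [initVector, he, h1, h2]

theorem Orientation.walkVector_eq_sum (D : G.Orientation) (W : Cycle H) :
    D.walkVector W =
      (W.toMultiset.map fun h => D.initVector h - D.initVector (G.mate h)).sum := by
  classical
  unfold walkVector
  generalize W.toMultiset = s
  induction s using Multiset.induction_on with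
  | empty => ext e; simp
  | cons a s ih =>
    rw [Multiset.map_cons, Multiset.sum_cons, ← ih]
    ext e
    rw [Pi.add_apply, D.initVector_sub]
    simp only [Multiset.count_cons, @eq_comm _ a]
    push_cast
    ring

theorem EulerSystem.IsFundamentalCircuit.isClosedWalk {C : G.EulerSystem} {v : V} {W : Cycle H}
    (h : C.IsFundamentalCircuit v W) : G.IsClosedWalk W := by
  obtain ⟨K, h₁, l₁, h₂, l₂, hK, e₁, e₂, rfl⟩ := h
  have hc := (C.isCircuit K).isClosedWalk
  rw [hK] at hc
  have h1 := isChain_of_chain_append hc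
  refine (Cycle.chain_coe_cons _ _ _).2 ?_
  have e : ∀ b, h₁ :: (l₁ ++ [b]) = (h₁ :: l₁) ++ [b] := fun _ => rfl
  rw [e, List.isChain_append] at h1 ⊢
  refine ⟨h1.1, by simp, ?_⟩
  intro x hx y hy
  have hy' : y = h₁ := by simpa using hy.symm
  rw [hy', h1.2.2 x hx h₂ (by simp), e₁, e₂]

theorem componentMk_vert_mate (h : H) :
    G.componentMk (G.vert (G.mate h)) = G.componentMk (G.vert h) :=
  (Quot.sound ⟨h, rfl, rfl⟩).symm

end Walks

/-! ### Projection to the touch-graph -/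

namespace CircuitPartition

variable {V E H : Type*} {G : HalfEdgeGraph V E H} (P : G.CircuitPartition)

/-- A passage of a walk of `G` which does not follow the partition projects to the traversal of a whole
edge of the touch-graph. -/
theorem mate_proj (hG : G.IsFourRegular) {h k : H} (hv : G.vert h = G.vert k)
    (hne : P.proj h ≠ P.proj k) : (P.touchGraph hG).mate (P.proj h) = P.proj k :=
  (((P.touchGraph hG).eq_or_eq_mate (h := P.proj h) (k := P.proj k) hv.symm).resolve_left
    hne.symm).symm

open Classical in
/-- The deleted steps of a projection do no harm: they stay on one circuit of the partition, which is
a single vertex of the touch-graph. -/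
theorem isWalk_filterMap_zip (hG : G.IsFourRegular) {b : H} :
    ∀ {a : H} {l : List H},
      List.IsChain (fun h k => G.vert (G.mate h) = G.vert k) (a :: (l ++ [b])) →
      (P.touchGraph hG).IsWalk (P.circuitOf (G.edge a))
        ((List.zip (a :: l) (l ++ [b])).filterMap fun p =>
          if P.proj (G.mate p.1) = P.proj p.2 then none else some (P.proj (G.mate p.1)))
        (P.circuitOf (G.edge b)) := by
  have key : ∀ {a c : H} {l : List P.TouchHalfEdge} {v : P.circuits},
      G.vert (G.mate a) = G.vert c → (P.touchGraph hG).IsWalk (P.circuitOf (G.edge c)) l v →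
      (P.touchGraph hG).IsWalk (P.circuitOf (G.edge a))
        ((if P.proj (G.mate a) = P.proj c then (none : Option P.TouchHalfEdge)
          else some (P.proj (G.mate a))).toList ++ l) v := by
    intro a c l v hac hl
    split_ifs with hp
    · have h1 : P.circuitOf (G.edge (G.mate a)) = P.circuitOf (G.edge c) :=
        congrArg P.touchVert hp
      rw [edge_mate] at h1
      rw [h1]
      exact hl
    · refine ⟨?_, ?_⟩
      · change P.circuitOf (G.edge (G.mate a)) = _
        rw [edge_mate]
      · rw [P.mate_proj hG hac hp]
        exact hl
  intro a l
  induction l generalizing a with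
  | nil =>
    intro h
    have h1 : G.vert (G.mate a) = G.vert b := by simpa using h
    have h2 := key (l := []) h1 rfl
    simp only [List.nil_append, List.zip_cons_cons, List.zip_nil_right, List.filterMap_cons,
      List.filterMap_nil]
    split_ifs with hp <;> simpa [hp] using h2
  | cons c l ih =>
    intro h
    rw [List.cons_append, List.isChain_cons_cons] at h
    have h2 := key h.1 (ih h.2)
    simp only [List.cons_append, List.zip_cons_cons, List.filterMap_cons] at h2 ⊢
    split_ifs with hp <;> simpa [hp] using h2

theorem isClosedWalk_projWalk (hG : G.IsFourRegular) {W : Cycle H} (hW : G.IsClosedWalk W) :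
    (P.touchGraph hG).IsClosedWalk (P.projWalk W) := by
  induction W using Cycle.induction_on with
  | nil => trivial
  | cons a l _ =>
    have h := P.isWalk_filterMap_zip hG ((Cycle.chain_coe_cons _ a l).1 hW)
    exact IsWalk.isClosedWalk (l := P.projList (a :: l)) (by simpa [projList] using h)

/-- The vector of a projected walk is a sum over the half-edges of the original walk. In this form
it makes sense for arbitrary chains, and single transitions of the partition contribute nothing. -/
theorem walkVector_projWalk (hG : G.IsFourRegular) (D : (P.touchGraph hG).Orientation)
    {W : Cycle H} (hW : G.IsClosedWalk W) :
    D.walkVector (P.projWalk W) = (W.toMultiset.map fun h =>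
      D.initVector (P.proj (G.mate h)) - D.initVector (P.proj h)).sum := by
  classical
  rw [D.walkVector_eq_sum]
  induction W using Cycle.induction_on with
  | nil => rfl
  | cons a l _ =>
    have hz := forall_mem_zip_of_isChain ((Cycle.chain_coe_cons _ a l).1 hW)
    have e1 : ((P.projWalk ((a :: l : List H) : Cycle H)).toMultiset.map fun t =>
        D.initVector t - D.initVector ((P.touchGraph hG).mate t)).sum =
        ((P.projList (a :: l)).map fun t =>
          D.initVector t - D.initVector ((P.touchGraph hG).mate t)).sum := rfl
    have e2 : ∀ m : List (H × H), (∀ p ∈ m, G.vert (G.mate p.1) = G.vert p.2) →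
        ((m.filterMap fun p => if P.proj (G.mate p.1) = P.proj p.2 then none
          else some (P.proj (G.mate p.1))).map fun t =>
            D.initVector t - D.initVector ((P.touchGraph hG).mate t)).sum =
          ((m.map Prod.fst).map fun h => D.initVector (P.proj (G.mate h))).sum -
            ((m.map Prod.snd).map fun h => D.initVector (P.proj h)).sum := by
      intro m
      induction m with
      | nil => simp
      | cons p m ih =>
        intro hm
        have h1 := ih fun q hq => hm q (List.mem_cons_of_mem _ hq)
        have h2 := hm p List.mem_cons_self
        rw [List.filterMap_cons]
        simp only [List.map_cons, List.sum_cons]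
        split_ifs with hp
        · simp only [h1, hp]
          abel
        · simp only [List.map_cons, List.sum_cons, h1, P.mate_proj hG h2 hp]
          abel
    have e3 : List.zip (a :: l) ((a :: l).rotate 1) = List.zip (a :: l) (l ++ [a]) := by simp
    rw [e1, projList, e3, e2 _ hz, List.map_fst_zip (by simp), List.map_snd_zip (by simp)]
    simp only [Cycle.coe_toMultiset, Multiset.map_coe, Multiset.sum_coe, List.map_append,
      List.sum_append, List.map_cons, List.sum_cons, List.map_nil, List.sum_nil]
    have e4 : ∀ (f g : H → V → ℝ) (l : List H),
        (l.map fun h => f h - g h).sum = (l.map f).sum - (l.map g).sum := by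
      intro f g l
      induction l with
      | nil => simp
      | cons a l ih => simp only [List.map_cons, List.sum_cons, ih]; abel
    rw [e4 (fun h => D.initVector (P.proj (G.mate h))) fun h => D.initVector (P.proj h)]
    abel

end CircuitPartition

/-! ### The orientation of a circuit partition -/

namespace CircuitPartition

variable {V E H : Type*} {G : HalfEdgeGraph V E H} (P : G.CircuitPartition)

/-- The half-edges along which the circuits of the partition leave vertices: one half-edge of each
edge. -/
def outSet : Set H := {h | ∃ W ∈ P.circuits, h ∈ W}

theorem mate_mem_outSet {h : H} : G.mate h ∈ P.outSet ↔ h ∉ P.outSet := by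
  constructor
  · rintro ⟨W, hW, hh⟩ ⟨W', hW', hh'⟩
    obtain rfl : W' = W := (P.eq_circuitOf hW' ⟨h, hh', rfl⟩).trans
      (P.eq_circuitOf hW ⟨_, hh, G.edge_mate h⟩).symm
    exact (P.isCircuit _ hW).mate_notMem hh' hh
  · intro hn
    obtain ⟨W, hW, hh | hh⟩ := P.exists_mem h
    · exact absurd ⟨W, hW, hh⟩ hn
    · exact ⟨W, hW, hh⟩

theorem partner_mem_outSet {h : H} : P.partner h ∈ P.outSet ↔ h ∉ P.outSet := by
  classical
  have key : ∀ h ∈ P.outSet, P.partner h ∉ P.outSet := by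
    rintro h ⟨W, hW, hh⟩
    rw [P.partner_of_mem hW hh, mate_mem_outSet, not_not]
    exact ⟨W, hW, Cycle.prev_mem _ _ _ _⟩
  refine ⟨fun h1 h2 => key h h2 h1, fun hn => ?_⟩
  rw [← mate_mem_outSet] at hn
  obtain ⟨W, hW, hh⟩ := hn
  rw [P.partner_of_mate_mem hW hh]
  exact ⟨W, hW, Cycle.next_mem _ _ _ _⟩

open Classical in
theorem partner_mate_of_mem {W : Cycle H} (hW : W ∈ P.circuits) {h : H} (hh : h ∈ W) :
    P.partner (G.mate h) = W.next (P.isCircuit W hW).nodup h hh := by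
  rw [P.partner_of_mate_mem hW (by simpa using hh)]
  simp

open Classical in
/-- A function which does not distinguish the two half-edges of a single transition has
increments along the circuits of the partition that add up to zero. -/
theorem sum_outSet_sub [Fintype H] {M : Type*} [AddCommGroup M] (f : H → M)
    (hf : ∀ h, f (P.partner h) = f h) :
    ∑ h with h ∈ P.outSet, (f (G.mate h) - f h) = 0 := by
  rw [Finset.sum_sub_distrib, sub_eq_zero]
  refine Finset.sum_nbij' (fun h => P.partner (G.mate h)) (fun h => G.mate (P.partner h)) ?_ ?_ ?_ ?_
    ?_
  · intro h hh
    simpa [partner_mem_outSet, mate_mem_outSet] using hh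
  · intro h hh
    simpa [partner_mem_outSet, mate_mem_outSet] using hh
  · intro h _; simp
  · intro h _; simp
  · intro h _; exact (hf _).symm

/-- A function which is the same at both half-edges of each edge and of each single transition is
constant on each circuit of the partition. -/
theorem eq_of_circuitOf_eq {M : Type*} (θ : H → M) (hm : ∀ h, θ (G.mate h) = θ h)
    (hp : ∀ h, θ (P.partner h) = θ h) {h k : H}
    (hk : P.circuitOf (G.edge h) = P.circuitOf (G.edge k)) : θ h = θ k := by
  classical
  have hcycle : ∀ (W : Cycle H) (hn : W.Nodup), (∀ x (hx : x ∈ W), θ (W.next hn x hx) = θ x) →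
      ∀ x ∈ W, ∀ y ∈ W, θ x = θ y := by
    intro W
    induction W using Cycle.induction_on with
    | nil => intro _ _ x hx; exact absurd hx (Cycle.notMem_nil x)
    | cons a l _ =>
      intro hn hnext
      have hconst : ∀ i (hi : i < (a :: l).length), θ (a :: l)[i] = θ a := by
        intro i
        induction i with
        | zero => intro _; rfl
        | succ i ih =>
          intro hi
          have hi' : i < (a :: l).length := by omega
          have h1 : θ ((a :: l).next (a :: l)[i] (List.getElem_mem hi')) = θ (a :: l)[i] :=
            hnext _ (Cycle.mem_coe_iff.2 (List.getElem_mem hi'))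
          rw [List.next_getElem _ hn i hi'] at h1
          simp only [Nat.mod_eq_of_lt hi] at h1
          rw [h1, ih]
      have hconst' : ∀ x ∈ a :: l, θ x = θ a := by
        intro x hx
        obtain ⟨i, hi, rfl⟩ := List.mem_iff_getElem.1 hx
        exact hconst i hi
      intro x hx y hy
      rw [hconst' x hx, hconst' y hy]
  have hW := (P.circuitOf (G.edge h)).2
  have hcirc := hcycle _ (P.isCircuit _ hW).nodup fun x hx => by
    rw [← P.partner_mate_of_mem hW hx, hp, hm]
  have hrep : ∀ x, P.circuitOf (G.edge x) = P.circuitOf (G.edge h) →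
      ∃ y ∈ (P.circuitOf (G.edge h) : Cycle H), θ y = θ x := by
    intro x hx
    obtain ⟨y, hy, hyx⟩ := P.traverses_circuitOf (G.edge x)
    rw [hx] at hy
    rcases G.eq_or_eq_mate hyx with rfl | rfl
    · exact ⟨_, hy, rfl⟩
    · exact ⟨_, hy, hm x⟩
  obtain ⟨a, ha, hah⟩ := hrep h rfl
  obtain ⟨b, hb, hbk⟩ := hrep k hk.symm
  rw [← hah, ← hbk]
  exact hcirc a ha b hb

open Classical in
/-- Comparison of two orientations: for an antisymmetric function, the difference of the sums is twice
the sum over the edges on which the orientations disagree. -/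
theorem sum_outSet_sub_sum_outSet [Fintype H] (Q : G.CircuitPartition) {M : Type*} [AddCommGroup M]
    (f : H → M) (hf : ∀ h, f (G.mate h) = -f h) :
    ∑ h with h ∈ Q.outSet, f h - ∑ h with h ∈ P.outSet, f h =
      2 • ∑ h with h ∈ Q.outSet ∧ h ∉ P.outSet, f h := by
  have e1 : ∑ h with h ∈ Q.outSet, f h = ∑ h with h ∈ Q.outSet ∧ h ∈ P.outSet, f h +
      ∑ h with h ∈ Q.outSet ∧ h ∉ P.outSet, f h := by
    rw [← Finset.sum_filter_add_sum_filter_not _ (· ∈ P.outSet), Finset.filter_filter,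
      Finset.filter_filter]
  have e2 : ∑ h with h ∈ P.outSet, f h = ∑ h with h ∈ Q.outSet ∧ h ∈ P.outSet, f h +
      ∑ h with h ∈ P.outSet ∧ h ∉ Q.outSet, f h := by
    rw [← Finset.sum_filter_add_sum_filter_not _ (· ∈ Q.outSet), Finset.filter_filter,
      Finset.filter_filter]
    simp only [and_comm]
  have e3 : ∑ h with h ∈ P.outSet ∧ h ∉ Q.outSet, f h =
      -∑ h with h ∈ Q.outSet ∧ h ∉ P.outSet, f h := by
    rw [← Finset.sum_neg_distrib]
    refine Finset.sum_nbij' G.mate G.mate ?_ ?_ ?_ ?_ ?_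
    · intro h hh
      simpa [mate_mem_outSet, and_comm] using hh
    · intro h hh
      simpa [mate_mem_outSet, and_comm] using hh
    · intro h _; simp
    · intro h _; simp
    · intro h _; simp [hf]
  rw [e1, e2, e3]
  abel

open Classical in
/-- The edges on which two orientations disagree, directed as in one of them, form a balanced
digraph. -/
theorem sum_outSet_diff_sub [Finite V] [Fintype H] (Q : G.CircuitPartition) {M : Type*}
    [AddCommGroup M] (ψ : V → M) :
    ∑ h with h ∈ Q.outSet ∧ h ∉ P.outSet, (ψ (G.vert (G.mate h)) - ψ (G.vert h)) = 0 := by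
  have := Fintype.ofFinite V
  -- Twice the sum vanishes, because it is a difference of two sums over circuit partitions; so the
  -- claim holds for the universal `ψ`, which has values in the torsion-free group `V → ℤ`.
  let δ : V → V → ℤ := fun v => Pi.single v 1
  have hδ : ∑ h with h ∈ Q.outSet ∧ h ∉ P.outSet, (δ (G.vert (G.mate h)) - δ (G.vert h)) = 0 := by
    have h2 := P.sum_outSet_sub_sum_outSet Q
      (fun h => δ (G.vert (G.mate h)) - δ (G.vert h)) (fun h => by simp)
    rw [Q.sum_outSet_sub (fun h => δ (G.vert h)) (fun h => by rw [vert_partner]),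
      P.sum_outSet_sub (fun h => δ (G.vert h)) (fun h => by rw [vert_partner]), sub_zero] at h2
    funext v
    have h3 := congrFun h2 v
    simp only [Pi.zero_apply, Pi.smul_apply, nsmul_eq_mul] at h3 ⊢
    push_cast at h3
    linarith
  let L : (V → ℤ) →+ M :=
    { toFun := fun c => ∑ v, c v • ψ v
      map_zero' := by simp
      map_add' := fun a b => by simp [add_smul, Finset.sum_add_distrib] }
  have hL : ∀ v, L (δ v) = ψ v := fun v => by
    simp [L, δ, Pi.single_apply]
  have h4 := congrArg L hδ
  rw [map_sum, map_zero] at h4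
  simpa only [map_sub, hL] using h4

end CircuitPartition

/-! ### Potentials from fundamental circuits -/

namespace EulerSystem

variable {V E H : Type*} {G : HalfEdgeGraph V E H} (C : G.EulerSystem)

theorem componentMk_of_mem {K : G.Component} {h : H} (hh : h ∈ C.circuit K) :
    G.componentMk (G.vert h) = K :=
  (C.traverses_iff K h).1 ⟨h, hh, rfl⟩

/-- The circuits of an Euler system form a circuit partition. -/
def toCircuitPartition : G.CircuitPartition where
  circuits := Set.range C.circuit
  isCircuit := by
    rintro _ ⟨K, rfl⟩
    exact C.isCircuit K
  existsUnique e := by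
    obtain ⟨h, rfl⟩ : ∃ h, G.edge h = e :=
      Set.nonempty_of_ncard_ne_zero (s := {h | G.edge h = e}) (by rw [G.ncard_edge]; decide)
    refine ⟨C.circuit (G.componentMk (G.vert h)), ⟨⟨_, rfl⟩, (C.traverses_iff _ h).2 rfl⟩, ?_⟩
    rintro _ ⟨⟨K, rfl⟩, hK⟩
    rw [(C.traverses_iff K h).1 hK]

theorem mem_outSet_and_iff {K : G.Component} {h : H} :
    h ∈ C.toCircuitPartition.outSet ∧ G.componentMk (G.vert h) = K ↔ h ∈ C.circuit K := by
  constructor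
  · rintro ⟨⟨_, ⟨K', rfl⟩, hh⟩, rfl⟩
    rwa [C.componentMk_of_mem hh]
  · exact fun hh => ⟨⟨_, ⟨K, rfl⟩, hh⟩, C.componentMk_of_mem hh⟩

theorem IsFundamentalCircuit.exists_component {C : G.EulerSystem} {v : V} {W : Cycle H}
    (h : C.IsFundamentalCircuit v W) : ∃ K, ∀ x ∈ W, G.componentMk (G.vert x) = K := by
  obtain ⟨K, h₁, l₁, h₂, l₂, hK, -, -, rfl⟩ := h
  refine ⟨K, fun x hx => C.componentMk_of_mem ?_⟩
  rw [hK]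
  exact Cycle.mem_coe_iff.2 (List.mem_append_left _ (Cycle.mem_coe_iff.1 hx))

/-- Over an abelian group of coefficients, an antisymmetric function on half-edges that has sum zero
along the circuits of an Euler system and along one fundamental circuit at each vertex is the
increment of a function on vertices. On the circuits of the Euler system the sum zero gives a
potential on the passages; the fundamental circuit at `v` says that this potential has the same value
at the two passages through `v`. -/
theorem exists_potential (hG : G.IsFourRegular) {M : Type*} [AddCommGroup M] (φ : H → M)
    (hanti : ∀ h, φ (G.mate h) = -φ h)
    (hC : ∀ K, ((C.circuit K).toMultiset.map φ).sum = 0)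
    (hfund : ∀ v, ∃ W, C.IsFundamentalCircuit v W ∧ (W.toMultiset.map φ).sum = 0) :
    ∃ ψ : V → M, ∀ h, φ h = ψ (G.vert (G.mate h)) - ψ (G.vert h) := by
  classical
  choose Φ' hΦ' using fun K => exists_chain_of_sum_eq_zero φ (C.isCircuit K).nodup (hC K)
  choose W hW hW0 using hfund
  choose K h₁ l₁ h₂ l₂ hK e₁ e₂ hWe using hW
  set Q := C.toCircuitPartition with hQ
  have hmem₁ : ∀ v, h₁ v ∈ C.circuit (K v) := fun v => by
    rw [hK]; exact Cycle.mem_coe_iff.2 (by simp)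
  have hmem₂ : ∀ v, h₂ v ∈ C.circuit (K v) := fun v => by
    rw [hK]; exact Cycle.mem_coe_iff.2 (by simp)
  let Φ : H → M := fun h => Φ' (G.componentMk (G.vert h)) h
  have hΦ : ∀ {K h}, h ∈ C.circuit K → Φ h = Φ' K h := fun {K h} hh => by
    simp only [Φ, C.componentMk_of_mem hh]
  have hout : ∀ h ∈ Q.outSet, Φ h = Φ (h₁ (G.vert h)) := by
    intro h hh
    generalize hv : G.vert h = v
    have h12 : h₁ v ≠ h₂ v := by
      have hn := (C.isCircuit (K v)).nodup
      rw [hK] at hn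
      have hn' : ((h₁ v :: l₁ v) ++ (h₂ v :: l₂ v)).Nodup := hn
      intro e
      rw [e] at hn'
      simp at hn'
    have ho₁ : h₁ v ∈ Q.outSet := ⟨_, ⟨K v, rfl⟩, hmem₁ v⟩
    have ho₂ : h₂ v ∈ Q.outSet := ⟨_, ⟨K v, rfl⟩, hmem₂ v⟩
    have hp₁ : Q.partner (h₁ v) ∉ Q.outSet := fun k => Q.partner_mem_outSet.1 k ho₁
    have hp₂ : Q.partner (h₂ v) ∉ Q.outSet := fun k => Q.partner_mem_outSet.1 k ho₂
    have hp12 : Q.partner (h₁ v) ≠ Q.partner (h₂ v) := fun e => h12 (by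
      rw [← Q.partner_partner (h₁ v), e, Q.partner_partner])
    -- The two passages through `v` use up the four half-edges at `v`.
    have hcard : ({h₁ v, h₂ v, Q.partner (h₁ v), Q.partner (h₂ v)} : Set H).ncard = 4 := by
      have n1 : h₁ v ≠ Q.partner (h₁ v) := fun e => hp₁ (e ▸ ho₁)
      have n2 : h₁ v ≠ Q.partner (h₂ v) := fun e => hp₂ (e ▸ ho₁)
      have n3 : h₂ v ≠ Q.partner (h₁ v) := fun e => hp₁ (e ▸ ho₂)
      have n4 : h₂ v ≠ Q.partner (h₂ v) := fun e => hp₂ (e ▸ ho₂)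
      rw [Set.ncard_insert_of_notMem (by simp [h12, n1, n2]),
        Set.ncard_insert_of_notMem (by simp [n3, n4]), Set.ncard_pair hp12]
    have h4 := hG v
    have hfin : {h | G.vert h = v}.Finite := Set.finite_of_ncard_ne_zero (by omega)
    have hsub : ({h₁ v, h₂ v, Q.partner (h₁ v), Q.partner (h₂ v)} : Set H) ⊆
        {h | G.vert h = v} := by
      rintro x (rfl | rfl | rfl | rfl)
      · exact e₁ v
      · exact e₂ v
      · exact (Q.vert_partner _).trans (e₁ v)
      · exact (Q.vert_partner _).trans (e₂ v)
    have heq := Set.eq_of_subset_of_ncard_le hsub (by omega) hfin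
    have hx : h ∈ ({h₁ v, h₂ v, Q.partner (h₁ v), Q.partner (h₂ v)} : Set H) := heq ▸ hv
    rcases hx with rfl | rfl | rfl | rfl
    · rfl
    · have hc := hΦ' (K v)
      rw [hK] at hc
      have h5 := eq_add_sum_of_isChain (isChain_of_chain_append hc)
      have h6 := hW0 v
      rw [hWe] at h6
      have h7 : ((h₁ v :: l₁ v).map φ).sum = 0 := by simpa using h6
      rw [hΦ (hmem₂ v), hΦ (hmem₁ v), h5, h7, add_zero]
    · exact absurd hh hp₁
    · exact absurd hh hp₂
  have hmain : ∀ h ∈ Q.outSet,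
      φ h = Φ (h₁ (G.vert (G.mate h))) - Φ (h₁ (G.vert h)) := by
    rintro h ⟨_, ⟨K, rfl⟩, hh⟩
    have hn := (C.isCircuit K).nodup
    have hk := Cycle.next_mem _ hn h hh
    have hstep := chain_next hn (hΦ' K) hh
    have hvert := chain_next hn (C.isCircuit K).isClosedWalk hh
    rw [hvert, ← hout _ ⟨_, ⟨K, rfl⟩, hh⟩, ← hout _ ⟨_, ⟨K, rfl⟩, hk⟩, hΦ hh, hΦ hk, hstep]
    abel
  refine ⟨fun v => Φ (h₁ v), fun h => ?_⟩
  by_cases hh : h ∈ Q.outSet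
  · exact hmain h hh
  · have h8 := hmain _ (Q.mate_mem_outSet.2 hh)
    rw [hanti, mate_mate] at h8
    rw [← neg_neg (φ h), h8, neg_sub]

end EulerSystem

/-! ### Euler circuits are spanned by fundamental circuits -/

namespace EulerSystem

variable {V E H : Type*} {G : HalfEdgeGraph V E H} (C : G.EulerSystem)

/-- Let `σ` be a function on half-edges, with values in a real vector space, which does not
distinguish the two half-edges of a single transition of a circuit partition. If the increment of `σ`
along one fundamental circuit at each vertex is zero, then so is its increment `m` along each circuit
of the Euler system. Indeed the Euler circuit is congruent modulo 2 to the circuits of the partition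
in the same component, and half of the difference is an integral cycle, whose increment is an
integral multiple of `m` by `exists_potential`. Hence an odd multiple of `m` is zero. -/
theorem sum_circuit_eq_zero [Finite V] [Finite H] (hG : G.IsFourRegular) {M : Type*}
    [AddCommGroup M] [Module ℝ M] (P : G.CircuitPartition) (σ : H → M)
    (hσ : ∀ h, σ (P.partner h) = σ h)
    (hfund : ∀ v, ∃ W, C.IsFundamentalCircuit v W ∧
      (W.toMultiset.map fun h => σ (G.mate h) - σ h).sum = 0) (K : G.Component) :
    ((C.circuit K).toMultiset.map fun h => σ (G.mate h) - σ h).sum = 0 := by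
  classical
  have := Fintype.ofFinite H
  set m := ((C.circuit K).toMultiset.map fun h => σ (G.mate h) - σ h).sum with hm
  set Q := C.toCircuitPartition
  -- `τ` is the restriction of `σ` to the component `K`.
  let τ : H → M := fun h => if G.componentMk (G.vert h) = K then σ h else 0
  have hτ : ∀ h, τ (G.mate h) - τ h =
      if G.componentMk (G.vert h) = K then σ (G.mate h) - σ h else 0 := by
    intro h
    simp only [τ, componentMk_vert_mate]
    split_ifs <;> simp
  have hτin : ∀ W : Cycle H, (∀ x ∈ W, G.componentMk (G.vert x) = K) →
      (W.toMultiset.map fun h => τ (G.mate h) - τ h).sum =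
        (W.toMultiset.map fun h => σ (G.mate h) - σ h).sum := by
    intro W hW
    congr 1
    refine Multiset.map_congr rfl fun x hx => ?_
    rw [hτ, if_pos (hW x (by
      induction W using Quotient.inductionOn' with
      | h l => exact hx))]
  have hτout : ∀ (W : Cycle H) K', K' ≠ K → (∀ x ∈ W, G.componentMk (G.vert x) = K') →
      (W.toMultiset.map fun h => τ (G.mate h) - τ h).sum = 0 := by
    intro W K' hK' hW
    refine Multiset.sum_eq_zero fun y hy => ?_
    obtain ⟨x, hx, rfl⟩ := Multiset.mem_map.1 hy
    rw [hτ, if_neg]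
    rw [hW x (by
      induction W using Quotient.inductionOn' with
      | h l => exact hx)]
    exact hK'
  have hP : ∑ h with h ∈ P.outSet, (τ (G.mate h) - τ h) = 0 :=
    P.sum_outSet_sub τ fun h => by simp only [τ, P.vert_partner, hσ]
  have hQ : ∑ h with h ∈ Q.outSet, (τ (G.mate h) - τ h) = m := by
    simp only [hτ]
    rw [← Finset.sum_filter, Finset.filter_filter, hm]
    have hnd : (C.circuit K).toMultiset.Nodup := by
      have hn := (C.isCircuit K).nodup
      generalize C.circuit K = W at hn
      induction W using Quotient.inductionOn' with
      | h l => exact hn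
    rw [← Finset.sum_mk _ hnd]
    refine Finset.sum_congr ?_ fun _ _ => rfl
    ext h
    rw [Finset.mem_filter, C.mem_outSet_and_iff]
    simp only [Finset.mem_univ, true_and, Finset.mem_mk]
    generalize C.circuit K = W
    induction W using Quotient.inductionOn' with
    | h l => exact Iff.rfl
  have hdiff := P.sum_outSet_sub_sum_outSet Q (fun h => τ (G.mate h) - τ h) (fun h => by simp)
  rw [hP, hQ, sub_zero] at hdiff
  -- Modulo integral multiples of `m`, the increment of `τ` vanishes on all Euler circuits, so that it
  -- has a potential `ψ` and vanishes on the balanced set of edges in `hdiff`.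
  let N := AddSubgroup.zmultiples m
  let q := QuotientAddGroup.mk' N
  have hq : ∀ W : Cycle H, (W.toMultiset.map fun h => q (τ (G.mate h) - τ h)).sum =
      q (W.toMultiset.map fun h => τ (G.mate h) - τ h).sum := by
    intro W
    rw [map_multiset_sum, Multiset.map_map]
    rfl
  obtain ⟨ψ, hψ⟩ := C.exists_potential hG (fun h => q (τ (G.mate h) - τ h))
    (fun h => by rw [← map_neg]; simp)
    (fun K' => by
      rw [hq]
      by_cases hK : K' = K
      · subst hK
        rw [hτin _ fun x hx => C.componentMk_of_mem hx]
        exact (QuotientAddGroup.eq_zero_iff _).2 (AddSubgroup.mem_zmultiples m)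
      · rw [hτout _ K' hK fun x hx => C.componentMk_of_mem hx, map_zero])
    (fun v => by
      obtain ⟨W, hW, hW0⟩ := hfund v
      refine ⟨W, hW, ?_⟩
      obtain ⟨K', hK'⟩ := hW.exists_component
      rw [hq]
      by_cases hK : K' = K
      · subst hK
        rw [hτin _ hK', hW0, map_zero]
      · rw [hτout _ K' hK hK', map_zero])
  have hbal := P.sum_outSet_diff_sub Q ψ
  simp only [← hψ] at hbal
  rw [← map_sum] at hbal
  obtain ⟨a, ha⟩ := AddSubgroup.mem_zmultiples_iff.1 ((QuotientAddGroup.eq_zero_iff _).1 hbal)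
  rw [← ha] at hdiff
  have hodd : ((1 : ℝ) - 2 * a) • m = 0 := by
    rw [sub_smul, one_smul, mul_smul, Int.cast_smul_eq_zsmul, two_smul, ← two_nsmul, ← hdiff,
      sub_self]
  refine (smul_eq_zero.1 hodd).resolve_left ?_
  intro h
  have h' : (1 : ℤ) - 2 * a = 0 := by exact_mod_cast h
  omega

end EulerSystem

/-! ### Spanning the cycle space of the touch-graph -/

theorem IsFourRegular.finite_halfEdge {V E H : Type*} [Finite V] {G : HalfEdgeGraph V E H}
    (hG : G.IsFourRegular) : Finite H := by
  rw [← Set.finite_univ_iff]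
  refine Set.Finite.of_finite_fibers G.vert (Set.toFinite _) fun v _ => ?_
  refine (Set.finite_of_ncard_ne_zero (s := {h | G.vert h = v}) (by rw [hG v]; decide)).subset ?_
  rintro h ⟨-, hh⟩
  exact hh

end HalfEdgeGraph

theorem mainTheorem2 {V E H : Type*} [Finite V] (F : HalfEdgeGraph V E H) (hF : F.IsFourRegular)
    (C : F.EulerSystem) (Γ : Set (Cycle H))
    (hΓ : ∀ γ ∈ Γ, ∃ v, C.IsFundamentalCircuit v γ)
    (hΓC : ∀ v, ∃ γ ∈ Γ, C.IsFundamentalCircuit v γ)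
    (P : F.CircuitPartition) (D : (P.touchGraph hF).Orientation) :
    Submodule.span ℝ {z | ∃ γ ∈ Γ, z = D.walkVector (P.projWalk γ)} = D.cycleSpace := by
  have := hF.finite_halfEdge
  refine le_antisymm (Submodule.span_le.2 ?_) ?_
  · rintro _ ⟨γ, hγ, rfl⟩
    obtain ⟨v, hv⟩ := hΓ γ hγ
    exact Submodule.subset_span ⟨_, P.isClosedWalk_projWalk hF hv.isClosedWalk, rfl⟩
  set N := Submodule.span ℝ {z | ∃ γ ∈ Γ, z = D.walkVector (P.projWalk γ)} with hN
  -- Modulo `N`, the vector of the projection of a closed walk of `F` is the increment of `σ`.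
  let σ : H → (V → ℝ) ⧸ N := fun h => N.mkQ (D.initVector (P.proj h))
  have hσ : ∀ h, σ (P.partner h) = σ h := fun h =>
    congrArg (fun t => N.mkQ (D.initVector t)) (P.proj_eq_proj.2 (Or.inr (by simp)))
  have hfund : ∀ v, ∃ W, C.IsFundamentalCircuit v W ∧
      (W.toMultiset.map fun h => σ (F.mate h) - σ h).sum = 0 := by
    intro v
    obtain ⟨γ, hγ, hv⟩ := hΓC v
    refine ⟨γ, hv, ?_⟩
    have h1 : N.mkQ (D.walkVector (P.projWalk γ)) = 0 :=
      (Submodule.Quotient.mk_eq_zero N).2 (Submodule.subset_span ⟨γ, hγ, rfl⟩)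
    rw [P.walkVector_projWalk hF D hv.isClosedWalk, map_multiset_sum, Multiset.map_map] at h1
    simpa [σ, Function.comp_def] using h1
  obtain ⟨ψ, hψ⟩ := C.exists_potential hF (fun h => σ (F.mate h) - σ h) (fun h => by simp)
    (C.sum_circuit_eq_zero hF P σ hσ hfund) hfund
  -- `θ` is constant on the circuits of `P`, so it is a potential on the touch-graph.
  let θ : H → (V → ℝ) ⧸ N := fun h => ψ (F.vert h) - σ h
  have hθm : ∀ h, θ (F.mate h) = θ h := fun h => by
    have h1 := hψ h
    simp only [θ]
    rw [sub_eq_sub_iff_sub_eq_sub, ← h1]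
  have hθp : ∀ h, θ (P.partner h) = θ h := fun h => by
    simp only [θ, P.vert_partner, hσ]
  obtain ⟨Θ, hΘ⟩ : ∃ Θ : P.circuits → (V → ℝ) ⧸ N, ∀ h, Θ (P.circuitOf (F.edge h)) = θ h := by
    refine ⟨Function.extend (fun h => P.circuitOf (F.edge h)) θ 0, fun h => ?_⟩
    exact Function.FactorsThrough.extend_apply
      (fun a b hab => P.eq_of_circuitOf_eq θ hθm hθp hab) 0 h
  have hstep : ∀ t, N.mkQ (D.initVector t - D.initVector ((P.touchGraph hF).mate t)) =
      Θ ((P.touchGraph hF).vert ((P.touchGraph hF).mate t)) - Θ ((P.touchGraph hF).vert t) := by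
    intro t
    obtain ⟨b, hb⟩ := P.proj_surjective ((P.touchGraph hF).mate t)
    obtain ⟨a, rfl⟩ := P.proj_surjective t
    have hv : F.vert b = F.vert a := by
      have h1 := (P.touchGraph hF).edge_mate (P.proj a)
      rw [← hb] at h1
      exact h1
    rw [← hb]
    change _ = Θ (P.circuitOf (F.edge b)) - Θ (P.circuitOf (F.edge a))
    rw [hΘ, hΘ, map_sub]
    simp only [θ, σ, hv]
    abel
  refine Submodule.span_le.2 ?_
  rintro _ ⟨W, hW, rfl⟩
  refine (Submodule.Quotient.mk_eq_zero N).1 ?_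
  change N.mkQ _ = 0
  rw [D.walkVector_eq_sum, map_multiset_sum, Multiset.map_map]
  simp only [Function.comp_def, hstep]
  exact hW.sum_sub Θ
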